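/- For $\theta_1,\theta_2,\theta_3\in\mathbb{R}$ let $\Theta=(\theta_1,\theta_2,\theta_3)^{T}$ (the case $m=1$, $n=3$ of simultaneous approximation) and, for $t\ge 1$, put $$\psi_\Theta(t)=\min_{x\in\mathbb{Z},\ 0<|x|\le t}\ \max_{1\le j\le 3}\|\theta_j x\|,$$ where $\|\cdot\|$ is the distance to the nearest integer. Let the uniform exponent $\alpha(\Theta)$ and the individual exponent $\beta(\Theta)\in(0,+\infty]$ be the suprema $$\alpha(\Theta)=\sup\{\gamma>0:\ \limsup_{t\to+\infty}t^\gamma\psi_\Theta(t)<+\infty\},\qquad \beta(\Theta)=\sup\{\gamma>0:\ \liminf_{t\to+\infty}t^\gamma\psi_\Theta(t)<+\infty\}.$$ For $\alpha>0$ put $$g_1(\alpha)=\frac{\alpha(1-\alpha)+\sqrt{\alpha^2(1-\alpha)^2+4\alpha(2\alpha^2-2\alpha+1)}}{2(2\alpha^2-2\alpha+1)};$$ this is the largest root of the equation $(2\alpha^2-2\alpha+1)x^2+\alpha(\alpha-1)x-\alpha=0$. **Theorem 2.** Suppose that $1,\theta_1,\theta_2,\theta_3$ are linearly independent over $\mathbb{Z}$.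 Then $\psi_\Theta(t)>0$ for all $t\ge1$, $\ \tfrac13\le\alpha(\Theta)\le1$, and $$\beta(\Theta)\ \ge\ \alpha(\Theta)\,g_1(\alpha(\Theta)).$$ This improves Jarník's bound $\beta(\Theta)\ge\alpha(\Theta)^2/(1-\alpha(\Theta))$ for $1/3<\alpha(\Theta)<\alpha_0$: the equation $x^3-x^2+2x-1=0$ has a unique real root $\alpha_0$, one has $1/3<\alpha_0<1$, and $\alpha\,g_1(\alpha)>\alpha^2/(1-\alpha)$ whenever $1/3<\alpha<\alpha_0$. -/

import Mathlib

noncomputable section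

namespace Diophantine

/-- The linear form `L_j(x) = ∑ i, θ_j^i x_i` at an integer vector `x`. -/
def linForm {n m : ℕ} (Θ : Matrix (Fin n) (Fin m) ℝ) (j : Fin n) (x : Fin m → ℤ) : ℝ :=
  ∑ i, Θ j i * (x i : ℝ)

/-- The distance from a real number to the nearest integer. -/
def distInt (r : ℝ) : ℝ := |r - (round r : ℝ)|

/-- `ζ(x) = max_j ‖L_j(x)‖`, where `‖·‖` is the distance to the nearest integer.
The norm on `Fin n → ℝ` is the maximum norm. -/
def zeta {n m : ℕ} (Θ : Matrix (Fin n) (Fin m) ℝ) (x : Fin m → ℤ) : ℝ :=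
  ‖fun j : Fin n => distInt (linForm Θ j x)‖

/-- `ψ_Θ(t)`, the minimum of `ζ(x)` over the integer vectors with `0 < max_i |x_i| ≤ t`.
The norm on `Fin m → ℤ` is the maximum norm, and the set of admissible vectors is finite and, for
`t ≥ 1` and `m ≥ 1`, non-empty, so that the infimum is a minimum. -/
def psi {n m : ℕ} (Θ : Matrix (Fin n) (Fin m) ℝ) (t : ℝ) : ℝ :=
  sInf (zeta Θ '' {x : Fin m → ℤ | 0 < ‖x‖ ∧ ‖x‖ ≤ t})

/-- The uniform exponent `α(Θ)`, as an extended real number. -/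
def uniformExponent {n m : ℕ} (Θ : Matrix (Fin n) (Fin m) ℝ) : EReal :=
  sSup ((fun γ : ℝ => (γ : EReal)) '' {γ : ℝ | 0 < γ ∧
    Filter.limsup (fun t : ℝ => ((t ^ γ * psi Θ t : ℝ) : EReal)) Filter.atTop < ⊤})

/-- The individual exponent `β(Θ)`, as an extended real number. -/
def individualExponent {n m : ℕ} (Θ : Matrix (Fin n) (Fin m) ℝ) : EReal :=
  sSup ((fun γ : ℝ => (γ : EReal)) '' {γ : ℝ | 0 < γ ∧
    Filter.liminf (fun t : ℝ => ((t ^ γ * psi Θ t : ℝ) : EReal)) Filter.atTop < ⊤})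

/-- The function `g₁`. -/
def g1 (a : ℝ) : ℝ :=
  (a * (1 - a) + √(a ^ 2 * (1 - a) ^ 2 + 4 * a * (2 * a ^ 2 - 2 * a + 1))) /
    (2 * (2 * a ^ 2 - 2 * a + 1))

end Diophantine

end

/-!
Let `X_k` be the denominators of the successive best approximations to `Θ` and `ζ_k` their errors.
By independence of `1, θ₁, …, θₙ`, three consecutive best integer points are infinitely often
linearly independent. When `n ≥ 3` they are orthogonal to a nonzero integer vector whose entries,
apart from the first, are `3 × 3` minors, hence of size `O(X_{k+2} ζ_k ζ_{k+1})`. Let `i` be the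
last index before the best points leave the hyperplane orthogonal to this vector; the vector has
scalar product at least `1` in absolute value with the next point, which forces
`X_i ≤ 36 X_{k+2} ζ_k ζ_{k+1} ζ_i X_{i+1}`. If all large gaps satisfied `X_{j+1} < X_j ^ g`, this
would contradict `ζ_j ≤ X_{j+1} ^ (-a)` as soon as `(1 - a) g² < a (g + 1)`; so
`X_{j+1} ≥ X_j ^ g` infinitely often, and `β(Θ) ≥ a g`. For `1/3 ≤ a ≤ 1` the number `g₁(a)`
satisfies this condition, possibly with equality, and letting `a → α(Θ)` and `g → g₁(α(Θ))` gives
the bound.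
-/

namespace Diophantine

open Filter Finset Matrix MeasureTheory Topology

/-! ### The function `g1` -/

theorem g1_denom_pos (a : ℝ) : 0 < 2 * a ^ 2 - 2 * a + 1 := by
  nlinarith [sq_nonneg (2 * a - 1)]

theorem isGreatest_g1 {a : ℝ} (ha : 0 < a) :
    IsGreatest {x : ℝ | (2 * a ^ 2 - 2 * a + 1) * x ^ 2 + a * (a - 1) * x - a = 0} (g1 a) := by
  have hA := g1_denom_pos a
  have hD : discrim (2 * a ^ 2 - 2 * a + 1) (a * (a - 1)) (-a) =
      √(a ^ 2 * (1 - a) ^ 2 + 4 * a * (2 * a ^ 2 - 2 * a + 1)) *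
        √(a ^ 2 * (1 - a) ^ 2 + 4 * a * (2 * a ^ 2 - 2 * a + 1)) := by
    rw [Real.mul_self_sqrt (by positivity), discrim]
    ring
  have hroots (x : ℝ) := quadratic_eq_zero_iff hA.ne' hD x
  have hb : -(a * (a - 1)) = a * (1 - a) := by ring
  simp only [hb, ← sub_eq_add_neg, ← sq] at hroots
  refine ⟨(hroots _).mpr (.inl rfl), fun x hx => ?_⟩
  rcases (hroots x).mp hx with rfl | rfl
  · exact le_rfl
  · unfold g1
    gcongr
    linarith [Real.sqrt_nonneg (a ^ 2 * (1 - a) ^ 2 + 4 * a * (2 * a ^ 2 - 2 * a + 1))]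

theorem g1_root {a : ℝ} (ha : 0 < a) :
    (2 * a ^ 2 - 2 * a + 1) * g1 a ^ 2 + a * (a - 1) * g1 a - a = 0 :=
  (isGreatest_g1 ha).1

theorem lt_g1_of_quadratic_neg {a x : ℝ}
    (hx : (2 * a ^ 2 - 2 * a + 1) * x ^ 2 + a * (a - 1) * x - a < 0) : x < g1 a := by
  have hA := g1_denom_pos a
  have hsqrt : 2 * (2 * a ^ 2 - 2 * a + 1) * x - a * (1 - a) <
      √(a ^ 2 * (1 - a) ^ 2 + 4 * a * (2 * a ^ 2 - 2 * a + 1)) :=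
    Real.lt_sqrt_of_sq_lt (by nlinarith [mul_neg_of_pos_of_neg hA hx])
  rw [g1, lt_div_iff₀ (by positivity)]
  linarith

theorem one_le_g1 {a : ℝ} (h3 : 1 / 3 ≤ a) (h1 : a ≤ 1) : 1 ≤ g1 a := by
  have ha : 0 < a := by linarith
  have hpos : 0 < g1 a := lt_g1_of_quadratic_neg (by linarith)
  have key : (g1 a - 1) * ((2 * a ^ 2 - 2 * a + 1) * g1 a + (3 * a ^ 2 - 3 * a + 1)) =
      (3 * a - 1) * (1 - a) := by
    linear_combination g1_root ha
  have hprod : 0 ≤ (3 * a - 1) * (1 - a) := mul_nonneg (by linarith) (by linarith)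
  refine sub_nonneg.1 (nonneg_of_mul_nonneg_left (hprod.trans_eq key.symm) ?_)
  have := mul_pos (g1_denom_pos a) hpos
  nlinarith [sq_nonneg (2 * a - 1)]

theorem one_sub_mul_g1_sq_le {a : ℝ} (h3 : 1 / 3 ≤ a) (h1 : a ≤ 1) :
    (1 - a) * g1 a ^ 2 ≤ a * (g1 a + 1) := by
  have ha : 0 < a := by linarith
  have key : (2 * a ^ 2 - 2 * a + 1) * (a * (g1 a + 1) - (1 - a) * g1 a ^ 2) =
      a ^ 2 * (a * (g1 a - 1) + (3 * a - 1)) := by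
    linear_combination -(1 - a) * g1_root ha
  have hnonneg : 0 ≤ a ^ 2 * (a * (g1 a - 1) + (3 * a - 1)) := by
    have := mul_nonneg ha.le (sub_nonneg.2 (one_le_g1 h3 h1))
    exact mul_nonneg (sq_nonneg a) (by linarith)
  exact sub_nonneg.1 (nonneg_of_mul_nonneg_right (hnonneg.trans_eq key.symm) (g1_denom_pos a))

theorem sq_div_one_sub_lt_mul_g1 {a : ℝ} (ha : 0 < a) (h1 : a < 1)
    (hcubic : a ^ 3 - a ^ 2 + 2 * a - 1 < 0) : a ^ 2 / (1 - a) < a * g1 a := by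
  have h1a : 0 < 1 - a := sub_pos.2 h1
  have hquad : (2 * a ^ 2 - 2 * a + 1) * (a / (1 - a)) ^ 2 + a * (a - 1) * (a / (1 - a)) - a =
      a * (a ^ 3 - a ^ 2 + 2 * a - 1) / (1 - a) ^ 2 := by
    field_simp
    ring
  have hlt : a / (1 - a) < g1 a := lt_g1_of_quadratic_neg <| hquad ▸
    div_neg_of_neg_of_pos (mul_neg_of_pos_of_neg ha hcubic) (by positivity)
  calc a ^ 2 / (1 - a) = a * (a / (1 - a)) := by ring
    _ < a * g1 a := mul_lt_mul_of_pos_left hlt ha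

theorem strictMono_cubic : StrictMono fun x : ℝ => x ^ 3 - x ^ 2 + 2 * x - 1 := by
  intro x y hxy
  have hquad : 0 < (y ^ 2 + x * y + x ^ 2) - (x + y) + 2 := by
    nlinarith [sq_nonneg (x + y - 1), sq_nonneg (x + y), sq_nonneg (x - y)]
  linarith [mul_pos (sub_pos.2 hxy) hquad]

theorem exists_unique_cubic_root_and_sq_div_one_sub_lt :
    ∃ α₀ : ℝ, (∀ x : ℝ, x ^ 3 - x ^ 2 + 2 * x - 1 = 0 ↔ x = α₀) ∧ 1 / 3 < α₀ ∧ α₀ < 1 ∧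
      ∀ a : ℝ, 1 / 3 < a → a < α₀ → a ^ 2 / (1 - a) < a * g1 a := by
  obtain ⟨r, ⟨h3, h1⟩, hr⟩ := intermediate_value_Ioo (by norm_num : (1 / 3 : ℝ) ≤ 1)
    (f := fun x : ℝ => x ^ 3 - x ^ 2 + 2 * x - 1) (by fun_prop)
    (show (0 : ℝ) ∈ _ by norm_num)
  exact ⟨r, fun x => ⟨fun hx => strictMono_cubic.injective (hx.trans hr.symm), fun hx => hx ▸ hr⟩,
    h3, h1, fun a ha har => sq_div_one_sub_lt_mul_g1 (by linarith) (har.trans h1)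
      ((strictMono_cubic har).trans_eq hr)⟩

/-! ### The function `psi` and the exponents -/

section Exponents

variable {n m : ℕ} {Θ : Matrix (Fin n) (Fin m) ℝ}

theorem linForm_neg (j : Fin n) (x : Fin m → ℤ) : linForm Θ j (-x) = -linForm Θ j x := by
  simp [linForm]

theorem zeta_eq_norm_unitAddCircle (x : Fin m → ℤ) :
    zeta Θ x = ‖fun j => (linForm Θ j x : UnitAddCircle)‖ := by
  simp only [zeta, distInt, ← UnitAddCircle.norm_eq, Pi.norm_def, nnnorm_norm]

theorem zeta_neg (x : Fin m → ℤ) : zeta Θ (-x) = zeta Θ x := by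
  simp only [zeta_eq_norm_unitAddCircle, linForm_neg, AddCircle.coe_neg, Pi.norm_def, nnnorm_neg]

theorem psi_le_zeta {t : ℝ} {x : Fin m → ℤ} (hx : x ≠ 0) (hxt : ‖x‖ ≤ t) :
    psi Θ t ≤ zeta Θ x :=
  csInf_le ⟨0, by rintro _ ⟨y, -, rfl⟩; exact norm_nonneg _⟩ ⟨x, ⟨norm_pos_iff.2 hx, hxt⟩, rfl⟩

theorem le_uniformExponent_of_eventually_le {γ C : ℝ} (hγ : 0 < γ)
    (h : ∀ᶠ t : ℝ in atTop, t ^ γ * psi Θ t ≤ C) : (γ : EReal) ≤ uniformExponent Θ := by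
  have hlimsup : limsup (fun t : ℝ => ((t ^ γ * psi Θ t : ℝ) : EReal)) atTop ≤ C :=
    limsup_le_of_le (h := h.mono fun t ht => EReal.coe_le_coe_iff.2 ht)
  exact le_sSup ⟨γ, ⟨hγ, hlimsup.trans_lt (EReal.coe_lt_top C)⟩, rfl⟩

theorem le_individualExponent_of_frequently_le {γ C : ℝ} (hγ : 0 < γ)
    (h : ∃ᶠ t : ℝ in atTop, t ^ γ * psi Θ t ≤ C) : (γ : EReal) ≤ individualExponent Θ := by
  have hliminf : liminf (fun t : ℝ => ((t ^ γ * psi Θ t : ℝ) : EReal)) atTop ≤ C :=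
    liminf_le_of_frequently_le' (h.mono fun t ht => EReal.coe_le_coe_iff.2 ht)
  exact le_sSup ⟨γ, ⟨hγ, hliminf.trans_lt (EReal.coe_lt_top C)⟩, rfl⟩

theorem uniformExponent_le_individualExponent : uniformExponent Θ ≤ individualExponent Θ :=
  sSup_le_sSup <| Set.image_mono fun _ hγ => ⟨hγ.1, lt_of_le_of_lt liminf_le_limsup hγ.2⟩

theorem eventually_psi_le_of_lt_uniformExponent {a C : ℝ} (hC : 0 < C)
    (ha : (a : EReal) < uniformExponent Θ) :
    ∀ᶠ t : ℝ in atTop, psi Θ t ≤ (C * t) ^ (-a) := by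
  obtain ⟨_, ⟨γ, ⟨-, hγ⟩, rfl⟩, haγ⟩ := lt_sSup_iff.1 ha
  obtain ⟨b, hb, -⟩ := EReal.lt_iff_exists_real_btwn.1 hγ
  have hdecay : Tendsto (fun t : ℝ => C ^ a * t ^ (-(γ - a)) * b) atTop (𝓝 0) := by
    simpa using ((tendsto_rpow_neg_atTop (sub_pos.2 (EReal.coe_lt_coe_iff.1 haγ))).const_mul
      (C ^ a)).mul_const b
  filter_upwards [eventually_lt_of_limsup_lt hb, hdecay.eventually_le_const one_pos,
    eventually_gt_atTop 0] with t htb ht1 ht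
  rw [Real.rpow_neg (by positivity), ← one_div, le_div_iff₀' (by positivity),
    Real.mul_rpow hC.le ht.le]
  calc C ^ a * t ^ a * psi Θ t = C ^ a * t ^ (-(γ - a)) * (t ^ γ * psi Θ t) := by
        rw [show a = -(γ - a) + γ by ring, Real.rpow_add ht]; ring_nf
    _ ≤ C ^ a * t ^ (-(γ - a)) * b := by
        gcongr
        exact (EReal.coe_lt_coe_iff.1 htb).le
    _ ≤ 1 := ht1

end Exponents

/-! ### Simultaneous approximation: the case `m = 1` -/

section ApproxError

variable {n : ℕ} {Θ : Matrix (Fin n) (Fin 1) ℝ} {q : ℕ} {t : ℝ}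

/-- The quality `max_j ‖q θ_j‖` of `q` as a common denominator of the `θ_j`. -/
noncomputable def approxError (Θ : Matrix (Fin n) (Fin 1) ℝ) (q : ℕ) : ℝ :=
  zeta Θ fun _ => (q : ℤ)

theorem zeta_eq_approxError (x : Fin 1 → ℤ) : zeta Θ x = approxError Θ (x 0).natAbs := by
  have hx : x = fun _ => x 0 := funext fun i => by rw [Subsingleton.elim i 0]
  rcases (x 0).natAbs_eq with h | h
  · rw [approxError, ← h, ← hx]
  · rw [approxError, ← zeta_neg, hx]
    congr 1
    ext
    exact neg_eq_iff_eq_neg.2 h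

theorem norm_fin_one_eq_natAbs (x : Fin 1 → ℤ) : ‖x‖ = ((x 0).natAbs : ℝ) := by
  rw [Nat.cast_natAbs, Int.cast_abs, ← Int.norm_eq_abs]
  simp [Pi.norm_def]

theorem approxError_nonneg (Θ : Matrix (Fin n) (Fin 1) ℝ) (q : ℕ) : 0 ≤ approxError Θ q :=
  norm_nonneg _

theorem abs_sub_round_le_approxError (j : Fin n) :
    |Θ j 0 * q - round (Θ j 0 * q)| ≤ approxError Θ q := by
  have h := norm_le_pi_norm (fun j => distInt (linForm Θ j fun _ => (q : ℤ))) j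
  simpa [approxError, zeta, distInt, linForm] using h

theorem psi_le_approxError (hq : 0 < q) (hqt : q ≤ t) : psi Θ t ≤ approxError Θ q :=
  psi_le_zeta (Function.ne_iff.2 ⟨0, by simpa using hq.ne'⟩)
    (by simpa [norm_fin_one_eq_natAbs] using hqt)

theorem le_psi {c : ℝ} (ht : 1 ≤ t) (h : ∀ q : ℕ, 0 < q → q ≤ t → c ≤ approxError Θ q) :
    c ≤ psi Θ t := by
  refine le_csInf ⟨_, 1, ⟨by simp, by simpa using ht⟩, rfl⟩ ?_
  rintro _ ⟨x, ⟨hx, hxt⟩, rfl⟩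
  rw [norm_fin_one_eq_natAbs] at hx hxt
  rw [zeta_eq_approxError]
  exact h _ (Nat.cast_pos.1 hx) hxt

theorem psi_pos (hΘ : ∀ q, 0 < q → 0 < approxError Θ q) (ht : 1 ≤ t) : 0 < psi Θ t := by
  obtain ⟨q, hq, hmin⟩ := (Icc 1 ⌊t⌋₊).exists_min_image (approxError Θ)
    ⟨1, by simpa [Nat.one_le_floor_iff] using ht⟩
  refine (hΘ q (mem_Icc.1 hq).1).trans_le (le_psi ht fun r hr hrt => hmin r ?_)
  exact mem_Icc.2 ⟨hr, Nat.le_floor hrt⟩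

theorem approxError_eq_norm_nsmul :
    approxError Θ q = ‖q • fun j => (Θ j 0 : UnitAddCircle)‖ := by
  rw [approxError, zeta_eq_norm_unitAddCircle]
  congr 1
  ext j
  simp [linForm, mul_comm]

theorem exists_approxError_le (Θ : Matrix (Fin n) (Fin 1) ℝ) {N : ℕ} (hN : 0 < N) {δ : ℝ}
    (hδ : 0 ≤ δ) (hδ1 : δ ≤ 1) (hNδ : 1 ≤ (N + 1) * δ ^ n) :
    ∃ q, 0 < q ∧ q ≤ N ∧ approxError Θ q ≤ δ := by
  obtain ⟨q, ⟨hq, hqN⟩, hqδ⟩ := NormedAddCommGroup.exists_norm_nsmul_le (μ := volume)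
    (fun j => (Θ j 0 : UnitAddCircle)) hN δ (by
      rw [volume_pi_closedBall _ (by positivity), volume_pi, Measure.pi_univ]
      simp only [Pi.zero_apply, AddCircle.measure_univ, AddCircle.volume_closedBall,
        mul_div_cancel₀ _ (two_ne_zero' ℝ), min_eq_right hδ1, prod_const, card_univ,
        Fintype.card_fin, ENNReal.ofReal_one, one_pow]
      rw [← ENNReal.ofReal_pow hδ, ← ENNReal.ofReal_nsmul, ENNReal.one_le_ofReal, nsmul_eq_mul]
      exact_mod_cast hNδ)
  exact ⟨q, hq, hqN, approxError_eq_norm_nsmul.trans_le hqδ⟩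

theorem exists_approxError_lt (Θ : Matrix (Fin n) (Fin 1) ℝ) {ε : ℝ} (hε : 0 < ε) :
    ∃ q, 0 < q ∧ approxError Θ q < ε := by
  obtain ⟨δ, hδ, hδε⟩ := exists_between (lt_min hε one_pos)
  obtain ⟨N, hN⟩ := exists_nat_gt (1 / δ ^ n)
  have hNδ : 1 ≤ N * δ ^ n := ((div_lt_iff₀ (by positivity)).1 hN).le
  have hN0 : 0 < N := Nat.cast_pos.1 ((by positivity : (0 : ℝ) < 1 / δ ^ n).trans hN)
  obtain ⟨q, hq, -, hqδ⟩ := exists_approxError_le Θ hN0 hδ.le (hδε.le.trans (min_le_right _ _))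
    (by linarith [pow_pos hδ n])
  exact ⟨q, hq, hqδ.trans_lt (hδε.trans_le (min_le_left _ _))⟩

theorem psi_le_rpow (hn : n ≠ 0) (ht : 1 ≤ t) : psi Θ t ≤ t ^ (-(1 / n : ℝ)) := by
  have hpow : (t ^ (-(1 / n : ℝ))) ^ n = t⁻¹ := by
    rw [← Real.rpow_mul_natCast (by linarith), neg_mul, one_div_mul_cancel (by positivity),
      Real.rpow_neg_one]
  obtain ⟨q, hq, hqt, hqδ⟩ := exists_approxError_le Θ (Nat.floor_pos.2 ht)
    (δ := t ^ (-(1 / n : ℝ))) (by positivity)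
    (Real.rpow_le_one_of_one_le_of_nonpos ht (by simp)) (by
      rw [hpow, ← div_eq_mul_inv, one_le_div (by linarith)]
      exact (Nat.lt_floor_add_one t).le)
  exact (psi_le_approxError hq (Nat.le_floor_iff (by linarith) |>.1 hqt)).trans hqδ

theorem one_div_le_uniformExponent (hn : n ≠ 0) :
    ((1 / n : ℝ) : EReal) ≤ uniformExponent Θ := by
  refine le_uniformExponent_of_eventually_le (C := 1) (by positivity) ?_
  filter_upwards [eventually_ge_atTop 1] with t ht
  rw [← le_div_iff₀' (by positivity), one_div (t ^ _), ← Real.rpow_neg (by linarith)]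
  exact psi_le_rpow hn ht

end ApproxError

/-! ### Best approximations -/

section BestDenom

variable {n : ℕ} {Θ : Matrix (Fin n) (Fin 1) ℝ} {q k : ℕ} {t : ℝ}

/-- `q` is the denominator of a best simultaneous approximation: it approximates strictly better
than every smaller positive integer. -/
def IsBestDenom (Θ : Matrix (Fin n) (Fin 1) ℝ) (q : ℕ) : Prop :=
  0 < q ∧ ∀ r, 0 < r → r < q → approxError Θ q < approxError Θ r

/-- The increasing sequence of the denominators of the best approximations, indexed from `0`. It is
meaningful only when there are infinitely many of them; otherwise `Nat.nth` is eventually `0`. -/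
noncomputable def bestDenom (Θ : Matrix (Fin n) (Fin 1) ℝ) : ℕ → ℕ :=
  Nat.nth (IsBestDenom Θ)

theorem exists_isBestDenom_le (hq : 0 < q) :
    ∃ p ≤ q, IsBestDenom Θ p ∧ approxError Θ p ≤ approxError Θ q := by
  classical
  have hex : ∃ p, 0 < p ∧ approxError Θ p ≤ approxError Θ q := ⟨q, hq, le_rfl⟩
  obtain ⟨hpos, hle⟩ := Nat.find_spec hex
  refine ⟨Nat.find hex, Nat.find_min' hex ⟨hq, le_rfl⟩, ⟨hpos, fun r hr hlt => ?_⟩, hle⟩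
  exact hle.trans_lt (not_le.1 fun h => Nat.find_min hex hlt ⟨hr, h⟩)

variable (hΘ : ∀ q, 0 < q → 0 < approxError Θ q)
include hΘ

theorem infinite_setOf_isBestDenom : {q | IsBestDenom Θ q}.Infinite := by
  refine Set.infinite_of_forall_exists_gt fun N => ?_
  have hN : (1 : ℝ) ≤ (N + 1 : ℕ) := by simp
  obtain ⟨q, hq, hlt⟩ := exists_approxError_lt Θ (psi_pos hΘ hN)
  obtain ⟨p, -, hp, hpq⟩ := exists_isBestDenom_le (Θ := Θ) hq
  refine ⟨p, hp, not_le.1 fun hpN => (hpq.trans_lt hlt).not_ge ?_⟩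
  exact psi_le_approxError hp.1 (Nat.cast_le.2 (hpN.trans N.le_succ))

theorem isBestDenom_bestDenom (k : ℕ) : IsBestDenom Θ (bestDenom Θ k) :=
  Nat.nth_mem_of_infinite (infinite_setOf_isBestDenom hΘ) k

theorem bestDenom_pos (k : ℕ) : 0 < bestDenom Θ k :=
  (isBestDenom_bestDenom hΘ k).1

theorem bestDenom_strictMono : StrictMono (bestDenom Θ) :=
  Nat.nth_strictMono (infinite_setOf_isBestDenom hΘ)

theorem approxError_bestDenom_strictAnti :
    StrictAnti fun k => approxError Θ (bestDenom Θ k) := fun _ k hlt =>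
  (isBestDenom_bestDenom hΘ k).2 _ (bestDenom_pos hΘ _) (bestDenom_strictMono hΘ hlt)

theorem tendsto_bestDenom : Tendsto (fun k => (bestDenom Θ k : ℝ)) atTop atTop :=
  tendsto_natCast_atTop_atTop.comp (bestDenom_strictMono hΘ).tendsto_atTop

theorem approxError_bestDenom_le (hq : 0 < q) (hqk : q < bestDenom Θ (k + 1)) :
    approxError Θ (bestDenom Θ k) ≤ approxError Θ q := by
  obtain ⟨p, hpq, hp, hle⟩ := exists_isBestDenom_le (Θ := Θ) hq
  refine le_trans ?_ hle
  have hpk : p ≤ bestDenom Θ k := Nat.le_nth_of_lt_nth_succ (hpq.trans_lt hqk) hp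
  rcases hpk.eq_or_lt with rfl | hlt
  · exact le_rfl
  · exact ((isBestDenom_bestDenom hΘ k).2 p hp.1 hlt).le

theorem approxError_bestDenom_le_psi (ht : 1 ≤ t) (htk : t < bestDenom Θ (k + 1)) :
    approxError Θ (bestDenom Θ k) ≤ psi Θ t :=
  le_psi ht fun _ hq hqt => approxError_bestDenom_le hΘ hq (Nat.cast_lt.1 (hqt.trans_lt htk))

theorem eventually_approxError_bestDenom_le_rpow {a : ℝ} (ha : (a : EReal) < uniformExponent Θ) :
    ∀ᶠ k in atTop, approxError Θ (bestDenom Θ k) ≤ (bestDenom Θ (k + 1) : ℝ) ^ (-a) := by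
  have htop : Tendsto (fun k => (bestDenom Θ (k + 1) : ℝ) / 2) atTop atTop :=
    ((tendsto_add_atTop_iff_nat 1).2 (tendsto_bestDenom hΘ)).atTop_div_const two_pos
  filter_upwards [htop.eventually (eventually_psi_le_of_lt_uniformExponent two_pos ha),
    htop.eventually_ge_atTop 1] with k hk h1
  rw [mul_div_cancel₀ _ two_ne_zero] at hk
  exact (approxError_bestDenom_le_psi hΘ h1 (by linarith)).trans hk

theorem mul_le_individualExponent_of_frequently {a g : ℝ} (ha : 0 < a) (hg : 0 < g)
    (hau : (a : EReal) < uniformExponent Θ)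
    (h : ∃ᶠ k in atTop, (bestDenom Θ k : ℝ) ^ g ≤ bestDenom Θ (k + 1)) :
    ((a * g : ℝ) : EReal) ≤ individualExponent Θ := by
  refine le_individualExponent_of_frequently_le (C := 1) (mul_pos ha hg) <|
    (tendsto_bestDenom hΘ).frequently <|
      (h.and_eventually (eventually_approxError_bestDenom_le_rpow hΘ hau)).mono
        fun k ⟨hgap, hk⟩ => ?_
  have hX : (0 : ℝ) < bestDenom Θ k := Nat.cast_pos.2 (bestDenom_pos hΘ k)
  have hX' : (0 : ℝ) < bestDenom Θ (k + 1) := Nat.cast_pos.2 (bestDenom_pos hΘ (k + 1))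
  calc (bestDenom Θ k : ℝ) ^ (a * g) * psi Θ (bestDenom Θ k)
      ≤ ((bestDenom Θ k : ℝ) ^ g) ^ a * (bestDenom Θ (k + 1) : ℝ) ^ (-a) := by
        rw [mul_comm a, Real.rpow_mul hX.le]
        gcongr
        exact (psi_le_approxError (bestDenom_pos hΘ k) le_rfl).trans hk
    _ ≤ (bestDenom Θ (k + 1) : ℝ) ^ a * (bestDenom Θ (k + 1) : ℝ) ^ (-a) := by gcongr
    _ = 1 := by rw [← Real.rpow_add hX', add_neg_cancel, Real.rpow_zero]

end BestDenom

/-! ### Minors and cofactor vectors -/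

section CofactorVec

variable {ι R : Type*} [CommRing R] {m : ℕ}

theorem dotProduct_eq_zero_of_det_eq_zero [Fintype ι] [IsDomain R] {x y z u : ι → R} {c : Fin 2 → ι}
    (hc : ((of ![x, y]).submatrix id c).det ≠ 0)
    (hdet : ∀ i, ((of ![x, y, z]).submatrix id (Fin.snoc c i : Fin 3 → ι)).det = 0)
    (hx : u ⬝ᵥ x = 0) (hy : u ⬝ᵥ y = 0) : u ⬝ᵥ z = 0 := by
  set D := ((of ![x, y]).submatrix id c).det
  have hD : D = x (c 0) * y (c 1) - x (c 1) * y (c 0) := det_fin_two _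
  have hz (i : ι) : D * z i = (x (c 0) * z (c 1) - x (c 1) * z (c 0)) * y i -
      (y (c 0) * z (c 1) - y (c 1) * z (c 0)) * x i := by
    have h : x (c 0) * y (c 1) * z i - x (c 0) * y i * z (c 1) - x (c 1) * y (c 0) * z i +
        x (c 1) * y i * z (c 0) + x i * y (c 0) * z (c 1) - x i * y (c 1) * z (c 0) = 0 :=
      (det_fin_three _).symm.trans (hdet i)
    linear_combination h + z i * hD
  have hcomb : D • z = (x (c 0) * z (c 1) - x (c 1) * z (c 0)) • y -
      (y (c 0) * z (c 1) - y (c 1) * z (c 0)) • x := funext hz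
  simpa [dotProduct_sub, hx, hy, hc] using congrArg (u ⬝ᵥ ·) hcomb

variable [DecidableEq ι]

/-- The vector of the signed maximal minors of `M` in the columns `c`, extended by zero to `ι`. It
is orthogonal to the rows of `M`; the columns `c` need not be distinct. -/
def cofactorVec (M : Matrix (Fin m) ι R) (c : Fin (m + 1) → ι) : ι → R :=
  ∑ j, Pi.single (c j) ((-1) ^ (j : ℕ) * (M.submatrix id (c ∘ j.succAbove)).det)

theorem cofactorVec_dotProduct [Fintype ι] (M : Matrix (Fin m) ι R) (c : Fin (m + 1) → ι)
    (w : ι → R) :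
    cofactorVec M c ⬝ᵥ w = ((of (vecCons w M)).submatrix id c).det := by
  rw [det_succ_row_zero, cofactorVec, sum_dotProduct]
  refine sum_congr rfl fun j _ => ?_
  rw [single_dotProduct, mul_right_comm]
  rfl

theorem cofactorVec_dotProduct_row [Fintype ι] (M : Matrix (Fin m) ι R) (c : Fin (m + 1) → ι)
    (a : Fin m) : cofactorVec M c ⬝ᵥ M a = 0 := by
  rw [cofactorVec_dotProduct]
  exact det_zero_of_row_eq (Fin.succ_ne_zero a).symm rfl

theorem cofactorVec_snoc_ne_zero {M : Matrix (Fin m) ι R} {c : Fin m → ι} {l : ι}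
    (hl : l ∉ Set.range c) (hM : (M.submatrix id c).det ≠ 0) :
    cofactorVec M (Fin.snoc c l : Fin (m + 1) → ι) ≠ 0 := by
  intro h
  have hcomp : (Fin.snoc c l : Fin (m + 1) → ι) ∘ (Fin.last m).succAbove = c := by
    ext j
    simp
  have hcoord : cofactorVec M (Fin.snoc c l : Fin (m + 1) → ι) l =
      (-1) ^ m * (M.submatrix id c).det := by
    rw [cofactorVec, Finset.sum_apply, Fin.sum_univ_castSucc, sum_eq_zero, hcomp]
    · simp
    · intro j _
      rw [Fin.snoc_castSucc, Pi.single_eq_of_ne fun hj => hl ⟨j, hj.symm⟩]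
  rw [h, Pi.zero_apply, eq_comm, ((isUnit_neg_one).pow m).mul_right_eq_zero] at hcoord
  exact hM hcoord

theorem sum_abs_cofactorVec_succ_le {n : ℕ} [LinearOrder R] [IsStrictOrderedRing R]
    (M : Matrix (Fin m) (Fin (n + 1)) R) {c : Fin (m + 1) → Fin (n + 1)} (hc : c 0 = 0) :
    ∑ i : Fin n, |cofactorVec M c i.succ| ≤
      ∑ j : Fin m, |(M.submatrix id (c ∘ j.succ.succAbove)).det| := by
  set w : Fin m → R := fun j => |(M.submatrix id (c ∘ j.succ.succAbove)).det|
  have hw0 (j : Fin m) : 0 ≤ w j := abs_nonneg _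
  have hcoord (i : Fin n) : |cofactorVec M c i.succ| ≤
      ∑ j, (Pi.single (c j.succ) (w j) : Fin (n + 1) → R) i.succ := by
    rw [cofactorVec, Finset.sum_apply, Fin.sum_univ_succ, hc,
      Pi.single_eq_of_ne (Fin.succ_ne_zero i), zero_add]
    refine (abs_sum_le_sum_abs _ _).trans_eq (sum_congr rfl fun j _ => ?_)
    rw [Pi.single_apply, Pi.single_apply, apply_ite abs, abs_mul, abs_neg_one_pow, one_mul,
      abs_zero]
  have htotal (j : Fin m) :
      ∑ i : Fin n, (Pi.single (c j.succ) (w j) : Fin (n + 1) → R) i.succ ≤ w j := by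
    have hnonneg : 0 ≤ (Pi.single (c j.succ) (w j) : Fin (n + 1) → R) := Pi.single_nonneg.2 (hw0 j)
    calc ∑ i : Fin n, (Pi.single (c j.succ) (w j) : Fin (n + 1) → R) i.succ
        ≤ ∑ i, (Pi.single (c j.succ) (w j) : Fin (n + 1) → R) i := by
          rw [Fin.sum_univ_succ]
          exact le_add_of_nonneg_left (hnonneg 0)
      _ = w j := Fintype.sum_pi_single' (c j.succ) (w j)
  exact (sum_le_sum fun i _ => hcoord i).trans <|
    sum_comm.trans_le (sum_le_sum fun j _ => htotal j)

theorem sum_abs_cofactorVec_succ_le_of_abs_det_le {n : ℕ}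
    {M : Matrix (Fin (m + 1)) (Fin (n + 1)) ℤ} {B : ℝ}
    (hB : ∀ c : Fin (m + 1) → Fin (n + 1), c 0 = 0 → |((M.submatrix id c).det : ℝ)| ≤ B)
    {c : Fin (m + 2) → Fin (n + 1)} (hc : c 0 = 0) :
    ∑ i : Fin n, |((cofactorVec M c i.succ : ℤ) : ℝ)| ≤ (m + 1) * B := by
  calc ∑ i : Fin n, |((cofactorVec M c i.succ : ℤ) : ℝ)|
      = ((∑ i : Fin n, |cofactorVec M c i.succ| : ℤ) : ℝ) := by
        simp only [Int.cast_sum, Int.cast_abs]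
    _ ≤ ((∑ j : Fin (m + 1), |(M.submatrix id (c ∘ j.succ.succAbove)).det| : ℤ) : ℝ) :=
        Int.cast_le.2 (sum_abs_cofactorVec_succ_le M hc)
    _ ≤ ∑ _j : Fin (m + 1), B := by
        simp only [Int.cast_sum, Int.cast_abs]
        refine sum_le_sum fun j _ => hB _ ?_
        rw [Function.comp_apply, Fin.succ_succAbove_zero, hc]
    _ = (m + 1) * B := by simp

end CofactorVec

/-! ### Integer points near the line through `(1, θ₁, …, θₙ)` -/

section ApproxPoint

variable {n : ℕ} {Θ : Matrix (Fin n) (Fin 1) ℝ} {p q r : ℕ}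

/-- The vector `(1, θ₁, …, θₙ)`, whose multiples the integer points below approximate. -/
def augment (Θ : Matrix (Fin n) (Fin 1) ℝ) : Fin (n + 1) → ℝ :=
  vecCons 1 fun j => Θ j 0

/-- The integer point `(q, a₁, …, aₙ)` in which `aⱼ` is the integer nearest to `q θⱼ`. -/
noncomputable def approxPoint (Θ : Matrix (Fin n) (Fin 1) ℝ) (q : ℕ) : Fin (n + 1) → ℤ :=
  vecCons (q : ℤ) fun j => round (Θ j 0 * q)

theorem augment_zero : augment Θ 0 = 1 := rfl

theorem approxPoint_zero : approxPoint Θ q 0 = q := rfl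

theorem abs_mul_augment_sub_approxPoint_le (i : Fin (n + 1)) :
    |q * augment Θ i - approxPoint Θ q i| ≤ approxError Θ q := by
  refine Fin.cases ?_ (fun j => ?_) i
  · simpa [augment, approxPoint] using approxError_nonneg Θ q
  · simpa [augment, approxPoint, mul_comm] using abs_sub_round_le_approxError (q := q) j

theorem approxError_le {c : ℝ} (hc : 0 ≤ c)
    (h : ∀ i, |q * augment Θ i - approxPoint Θ q i| ≤ c) : approxError Θ q ≤ c := by
  refine (pi_norm_le_iff_of_nonneg hc).2 fun j => ?_
  simpa [augment, approxPoint, distInt, linForm, mul_comm] using h j.succ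

theorem approxError_pos_of_linearIndependent (hn : n ≠ 0) (hΘ : LinearIndependent ℤ (augment Θ))
    (hq : 0 < q) : 0 < approxError Θ q := by
  refine (approxError_nonneg Θ q).lt_of_ne' fun h0 => hq.ne' ?_
  let j : Fin (n + 1) := Fin.succ ⟨0, Nat.pos_of_ne_zero hn⟩
  have hj : (q : ℝ) * augment Θ j = approxPoint Θ q j :=
    sub_eq_zero.1 (abs_nonpos_iff.1 (h0 ▸ abs_mul_augment_sub_approxPoint_le j))
  have hrel : ∑ i, ((Pi.single j (q : ℤ) - Pi.single 0 (approxPoint Θ q j) : Fin (n + 1) → ℤ) i) •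
      augment Θ i = 0 := by
    simp [sub_smul, Pi.single_apply, ite_smul, augment_zero, hj]
  simpa [j] using Fintype.linearIndependent_iff.1 hΘ _ hrel j

theorem abs_dotProduct_approxPoint_sub_le (u : Fin (n + 1) → ℤ) :
    |((u ⬝ᵥ approxPoint Θ q : ℤ) : ℝ) - q * ∑ i, u i * augment Θ i| ≤
      (∑ j : Fin n, |(u j.succ : ℝ)|) * approxError Θ q := by
  have hres : ((u ⬝ᵥ approxPoint Θ q : ℤ) : ℝ) - q * ∑ i, u i * augment Θ i =
      -∑ j : Fin n, u j.succ * (q * augment Θ j.succ - approxPoint Θ q j.succ) := by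
    rw [dotProduct, Fin.sum_univ_succ, Fin.sum_univ_succ, approxPoint_zero, augment_zero]
    push_cast
    simp only [mul_sub, sum_sub_distrib, mul_add, mul_sum, mul_left_comm (q : ℝ)]
    ring
  rw [hres, abs_neg, sum_mul]
  refine (abs_sum_le_sum_abs _ _).trans (sum_le_sum fun j _ => ?_)
  rw [abs_mul]
  gcongr
  exact abs_mul_augment_sub_approxPoint_le j.succ

theorem le_of_dotProduct_approxPoint_eq_zero {u : Fin (n + 1) → ℤ} (hqr : q ≤ r)
    (herr : approxError Θ r ≤ approxError Θ q) (hq : u ⬝ᵥ approxPoint Θ q = 0)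
    (hr : u ⬝ᵥ approxPoint Θ r ≠ 0) :
    (q : ℝ) ≤ 2 * (∑ j : Fin n, |(u j.succ : ℝ)|) * approxError Θ q * r := by
  set S := ∑ j : Fin n, |(u j.succ : ℝ)|
  set η := ∑ i, (u i : ℝ) * augment Θ i
  have : 0 ≤ S := sum_nonneg fun _ _ => abs_nonneg _
  have hqη : q * |η| ≤ S * approxError Θ q := by
    simpa [hq, abs_mul] using abs_dotProduct_approxPoint_sub_le (Θ := Θ) (q := q) u
  have hr0 := approxError_nonneg Θ r
  have hrη : 1 ≤ r * |η| + S * approxError Θ r := by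
    have hone : (1 : ℝ) ≤ |((u ⬝ᵥ approxPoint Θ r : ℤ) : ℝ)| := by
      exact_mod_cast Int.one_le_abs hr
    have htri := abs_sub_abs_le_abs_sub ((u ⬝ᵥ approxPoint Θ r : ℤ) : ℝ) (r * η)
    rw [abs_mul, Nat.abs_cast] at htri
    linarith [abs_dotProduct_approxPoint_sub_le (Θ := Θ) (q := r) u]
  calc (q : ℝ) ≤ q * (r * |η| + S * approxError Θ r) := le_mul_of_one_le_right (by positivity) hrη
    _ = r * (q * |η|) + q * (S * approxError Θ r) := by ring
    _ ≤ r * (S * approxError Θ q) + r * (S * approxError Θ q) := by gcongr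
    _ = 2 * S * approxError Θ q * r := by ring

theorem exists_det_approxPoint_ne_zero (hpr : p < r)
    (herr : approxError Θ r < approxError Θ p) :
    ∃ c : Fin 2 → Fin (n + 1), c 0 = 0 ∧
      ((of ![approxPoint Θ p, approxPoint Θ r]).submatrix id c).det ≠ 0 := by
  by_contra! hdet
  have hprop (i : Fin (n + 1)) :
      r * (p * augment Θ i - approxPoint Θ p i) = p * (r * augment Θ i - approxPoint Θ r i) := by
    have h : (p : ℤ) * approxPoint Θ r i - approxPoint Θ p i * r = 0 :=
      (det_fin_two _).symm.trans (hdet ![0, i] rfl)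
    have hR : (p : ℝ) * approxPoint Θ r i - approxPoint Θ p i * r = 0 := mod_cast h
    linear_combination hR
  have hr : (0 : ℝ) < r := Nat.cast_pos.2 (pos_of_gt hpr)
  refine herr.not_ge (approxError_le (approxError_nonneg Θ r) fun i => ?_)
  have hi : r * |p * augment Θ i - approxPoint Θ p i| ≤ r * approxError Θ r := by
    calc r * |p * augment Θ i - approxPoint Θ p i|
        = p * |r * augment Θ i - approxPoint Θ r i| := by
          simpa only [abs_mul, Nat.abs_cast] using congrArg abs (hprop i)
      _ ≤ r * approxError Θ r := by
          gcongr
          exact abs_mul_augment_sub_approxPoint_le i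
  exact le_of_mul_le_mul_left hi hr

theorem abs_det_two_approxPoint_le {c : Fin 2 → Fin (n + 1)} (hc : c 0 = 0) (hpr : p ≤ r)
    (herr : approxError Θ r ≤ approxError Θ p) :
    |(((of ![approxPoint Θ p, approxPoint Θ r]).submatrix id c).det : ℝ)| ≤
      2 * r * approxError Θ p := by
  have hdet : (((of ![approxPoint Θ p, approxPoint Θ r]).submatrix id c).det : ℝ) =
      r * (p * augment Θ (c 1) - approxPoint Θ p (c 1)) -
        p * (r * augment Θ (c 1) - approxPoint Θ r (c 1)) := by
    have h : ((of ![approxPoint Θ p, approxPoint Θ r]).submatrix id c).det =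
        (p : ℤ) * approxPoint Θ r (c 1) - approxPoint Θ p (c 1) * r := by
      simp [det_fin_two, hc, approxPoint_zero]
    rw [h]
    push_cast
    ring
  calc |(((of ![approxPoint Θ p, approxPoint Θ r]).submatrix id c).det : ℝ)|
      ≤ r * approxError Θ p + p * approxError Θ r := by
        rw [hdet]
        refine (abs_sub _ _).trans ?_
        rw [abs_mul, abs_mul, Nat.abs_cast, Nat.abs_cast]
        gcongr <;> exact abs_mul_augment_sub_approxPoint_le _
    _ ≤ r * approxError Θ p + r * approxError Θ p := by
        gcongr
        exact approxError_nonneg Θ r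
    _ = 2 * r * approxError Θ p := by ring

theorem one_le_two_mul_approxError (hpr : p < r) (herr : approxError Θ r < approxError Θ p) :
    1 ≤ 2 * r * approxError Θ p := by
  obtain ⟨c, hc0, hc⟩ := exists_det_approxPoint_ne_zero hpr herr
  have hone : (1 : ℝ) ≤
      |(((of ![approxPoint Θ p, approxPoint Θ r]).submatrix id c).det : ℝ)| := by
    exact_mod_cast Int.one_le_abs hc
  exact hone.trans (abs_det_two_approxPoint_le hc0 hpr.le herr.le)

theorem abs_mul_sub_mul_le {x y x' y' X Y : ℝ} (hx : |x| ≤ X) (hx' : |x'| ≤ X) (hy : |y| ≤ Y)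
    (hy' : |y'| ≤ Y) : |x * y' - x' * y| ≤ 2 * (X * Y) := by
  have hX : 0 ≤ X := (abs_nonneg x).trans hx
  calc |x * y' - x' * y| ≤ |x| * |y'| + |x'| * |y| := by
        simpa only [abs_mul] using abs_sub (x * y') (x' * y)
    _ ≤ X * Y + X * Y := by gcongr
    _ = 2 * (X * Y) := by ring

theorem abs_det_three_approxPoint_le {c : Fin 3 → Fin (n + 1)} (hc : c 0 = 0) (hpq : p ≤ q)
    (hqr : q ≤ r) (hq : approxError Θ q ≤ approxError Θ p)
    (hr : approxError Θ r ≤ approxError Θ q) :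
    |(((of ![approxPoint Θ p, approxPoint Θ q, approxPoint Θ r]).submatrix id c).det : ℝ)| ≤
      6 * r * approxError Θ p * approxError Θ q := by
  -- Subtracting multiples of the first column replaces the other two by approximation errors.
  set ρ : ℕ → Fin (n + 1) → ℝ := fun s i => s * augment Θ i - approxPoint Θ s i
  have hdet : (((of ![approxPoint Θ p, approxPoint Θ q, approxPoint Θ r]).submatrix id c).det : ℝ) =
      p * (ρ q (c 1) * ρ r (c 2) - ρ q (c 2) * ρ r (c 1)) -
        q * (ρ p (c 1) * ρ r (c 2) - ρ p (c 2) * ρ r (c 1)) +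
        r * (ρ p (c 1) * ρ q (c 2) - ρ p (c 2) * ρ q (c 1)) := by
    have h : ((of ![approxPoint Θ p, approxPoint Θ q, approxPoint Θ r]).submatrix id c).det =
        (p : ℤ) * approxPoint Θ q (c 1) * approxPoint Θ r (c 2) -
          p * approxPoint Θ q (c 2) * approxPoint Θ r (c 1) -
          approxPoint Θ p (c 1) * q * approxPoint Θ r (c 2) +
          approxPoint Θ p (c 1) * approxPoint Θ q (c 2) * r +
          approxPoint Θ p (c 2) * q * approxPoint Θ r (c 1) -
          approxPoint Θ p (c 2) * approxPoint Θ q (c 1) * r := by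
      simp [det_fin_three, hc, approxPoint_zero]
    rw [h]
    push_cast
    ring
  have hminor (s t : ℕ) : |ρ s (c 1) * ρ t (c 2) - ρ s (c 2) * ρ t (c 1)| ≤
      2 * (approxError Θ s * approxError Θ t) := by
    apply abs_mul_sub_mul_le <;> exact abs_mul_augment_sub_approxPoint_le _
  have hp0 := approxError_nonneg Θ p
  have hq0 := approxError_nonneg Θ q
  have hr0 := approxError_nonneg Θ r
  rw [hdet]
  calc _ ≤ p * (2 * (approxError Θ q * approxError Θ r)) +
        q * (2 * (approxError Θ p * approxError Θ r)) +
        r * (2 * (approxError Θ p * approxError Θ q)) := by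
        refine (abs_add_le _ _).trans (add_le_add ((abs_sub _ _).trans (add_le_add ?_ ?_)) ?_) <;>
        · rw [abs_mul, Nat.abs_cast]
          gcongr
          exact hminor _ _
    _ ≤ r * (2 * (approxError Θ p * approxError Θ q)) +
        r * (2 * (approxError Θ p * approxError Θ q)) +
        r * (2 * (approxError Θ p * approxError Θ q)) := by
        have hpr := hpq.trans hqr
        have hqr' : approxError Θ q * approxError Θ r ≤ approxError Θ p * approxError Θ q :=
          mul_le_mul hq hr hr0 hp0
        gcongr
    _ = 6 * r * approxError Θ p * approxError Θ q := by ring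

end ApproxPoint

/-! ### Gaps between consecutive best approximations -/

section Gap

variable {n : ℕ} {Θ : Matrix (Fin n) (Fin 1) ℝ} {k : ℕ}

/-- The integer point of the `k`-th best approximation. -/
noncomputable def bestPoint (Θ : Matrix (Fin n) (Fin 1) ℝ) (k : ℕ) : Fin (n + 1) → ℤ :=
  approxPoint Θ (bestDenom Θ k)

theorem frequently_dotProduct_bestPoint_ne_zero (hΘ : ∀ q, 0 < q → 0 < approxError Θ q)
    {u : Fin (n + 1) → ℤ} (hu : ∑ i, u i * augment Θ i ≠ 0) :
    ∃ᶠ k in atTop, u ⬝ᵥ bestPoint Θ k ≠ 0 := by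
  set η := ∑ i, u i * augment Θ i
  set S := ∑ j : Fin n, |(u j.succ : ℝ)|
  intro hzero
  have hlarge := ((tendsto_bestDenom hΘ).atTop_mul_const (abs_pos.2 hu)).eventually_gt_atTop
    (S * approxError Θ (bestDenom Θ 0))
  obtain ⟨k, hk0, hk⟩ := (hzero.and hlarge).exists
  have hkη := abs_dotProduct_approxPoint_sub_le (Θ := Θ) (q := bestDenom Θ k) u
  rw [← bestPoint, not_not.1 hk0, Int.cast_zero, zero_sub, abs_neg, abs_mul, Nat.abs_cast] at hkη
  refine (hkη.trans ?_).not_gt hk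
  gcongr
  exact (approxError_bestDenom_strictAnti hΘ).antitone k.zero_le

theorem sum_mul_augment_ne_zero (hΘ : LinearIndependent ℤ (augment Θ)) {u : Fin (n + 1) → ℤ}
    (hu : u ≠ 0) : ∑ i, u i * augment Θ i ≠ 0 := fun h =>
  hu (funext (Fintype.linearIndependent_iff.1 hΘ u (by simpa using h)))

theorem exists_orthogonal_not_orthogonal_succ (hΘ : ∀ q, 0 < q → 0 < approxError Θ q)
    {u : Fin (n + 1) → ℤ} (hu : ∑ i, u i * augment Θ i ≠ 0) (hk : u ⬝ᵥ bestPoint Θ k = 0) :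
    ∃ i ≥ k, u ⬝ᵥ bestPoint Θ i = 0 ∧ u ⬝ᵥ bestPoint Θ (i + 1) ≠ 0 := by
  by_contra! hsucc
  obtain ⟨i, hki, hi⟩ := frequently_atTop.1 (frequently_dotProduct_bestPoint_ne_zero hΘ hu) k
  exact hi (Nat.le_induction hk hsucc i hki)

theorem exists_notMem_range {m : ℕ} (hm : m < n) (c : Fin m → Fin n) : ∃ l, l ∉ Set.range c := by
  by_contra! h
  exact hm.not_ge (by simpa using Fintype.card_le_of_surjective c h)

variable (hΘ : LinearIndependent ℤ (augment Θ))
include hΘ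

theorem frequently_det_bestPoint_ne_zero (hn : 2 ≤ n) :
    ∃ᶠ k in atTop, ∃ c : Fin 3 → Fin (n + 1), c 0 = 0 ∧
      ((of ![bestPoint Θ k, bestPoint Θ (k + 1), bestPoint Θ (k + 2)]).submatrix id c).det ≠ 0 := by
  have hpos (q : ℕ) (hq : 0 < q) : 0 < approxError Θ q :=
    approxError_pos_of_linearIndependent (by lia) hΘ hq
  have hpair (k : ℕ) : ∃ c : Fin 2 → Fin (n + 1), c 0 = 0 ∧
      ((of ![bestPoint Θ k, bestPoint Θ (k + 1)]).submatrix id c).det ≠ 0 :=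
    exists_det_approxPoint_ne_zero (bestDenom_strictMono hpos k.lt_succ_self)
      (approxError_bestDenom_strictAnti hpos k.lt_succ_self)
  intro hdet
  obtain ⟨N, hN⟩ := eventually_atTop.1 hdet
  push Not at hN
  obtain ⟨c, -, hc⟩ := hpair N
  obtain ⟨l, hl⟩ := exists_notMem_range (by lia : 2 < n + 1) c
  set u := cofactorVec (of ![bestPoint Θ N, bestPoint Θ (N + 1)]) (Fin.snoc c l : Fin 3 → _)
  have hu : ∑ i, u i * augment Θ i ≠ 0 :=
    sum_mul_augment_ne_zero hΘ (cofactorVec_snoc_ne_zero hl hc)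
  have horth (k : ℕ) (hk : N ≤ k) : u ⬝ᵥ bestPoint Θ k = 0 ∧ u ⬝ᵥ bestPoint Θ (k + 1) = 0 := by
    induction k, hk using Nat.le_induction with
    | base => exact ⟨cofactorVec_dotProduct_row _ _ 0, cofactorVec_dotProduct_row _ _ 1⟩
    | succ k hk ih =>
      obtain ⟨c, hc0, hc⟩ := hpair k
      exact ⟨ih.2, dotProduct_eq_zero_of_det_eq_zero hc (fun i => hN k hk _ hc0) ih.1 ih.2⟩
  obtain ⟨k, hk, hne⟩ := frequently_atTop.1 (frequently_dotProduct_bestPoint_ne_zero hpos hu) N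
  exact hne (horth k hk).1

theorem frequently_exists_bestDenom_le (hn : 3 ≤ n) :
    ∃ᶠ k in atTop, ∃ i ≥ k + 2, (bestDenom Θ i : ℝ) ≤
      36 * bestDenom Θ (k + 2) * approxError Θ (bestDenom Θ k) *
        approxError Θ (bestDenom Θ (k + 1)) * approxError Θ (bestDenom Θ i) *
          bestDenom Θ (i + 1) := by
  have hpos (q : ℕ) (hq : 0 < q) : 0 < approxError Θ q :=
    approxError_pos_of_linearIndependent (by lia) hΘ hq
  have hmono := (bestDenom_strictMono hpos).monotone
  have hanti := (approxError_bestDenom_strictAnti hpos).antitone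
  refine (frequently_det_bestPoint_ne_zero hΘ (by lia)).mono fun k ⟨c, hc0, hc⟩ => ?_
  obtain ⟨l, hl⟩ := exists_notMem_range (by lia : 3 < n + 1) c
  set M := of ![bestPoint Θ k, bestPoint Θ (k + 1), bestPoint Θ (k + 2)]
  set u := cofactorVec M (Fin.snoc c l : Fin 4 → _)
  have hu : ∑ i, u i * augment Θ i ≠ 0 :=
    sum_mul_augment_ne_zero hΘ (cofactorVec_snoc_ne_zero hl hc)
  obtain ⟨i, hi, hi0, hi1⟩ := exists_orthogonal_not_orthogonal_succ hpos hu
    (cofactorVec_dotProduct_row M _ 2)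
  have hsum := sum_abs_cofactorVec_succ_le_of_abs_det_le (M := M) (c := (Fin.snoc c l : Fin 4 → _))
    (fun _ h => abs_det_three_approxPoint_le h (hmono k.le_succ) (hmono (k + 1).le_succ)
      (hanti k.le_succ) (hanti (k + 1).le_succ)) hc0
  refine ⟨i, hi, (le_of_dotProduct_approxPoint_eq_zero (hmono i.le_succ) (hanti i.le_succ)
    hi0 hi1).trans ?_⟩
  have hi_nonneg := approxError_nonneg Θ (bestDenom Θ i)
  calc _ ≤ 2 * (((2 : ℕ) + 1) * (6 * bestDenom Θ (k + 2) * approxError Θ (bestDenom Θ k) *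
          approxError Θ (bestDenom Θ (k + 1)))) *
        approxError Θ (bestDenom Θ i) * bestDenom Θ (i + 1) := by gcongr
    _ = _ := by
        push_cast
        ring

end Gap

/-! ### The uniform and the individual exponents -/

section Bounds

variable {n : ℕ} {Θ : Matrix (Fin n) (Fin 1) ℝ}

theorem uniformExponent_le_one (hΘ : ∀ q, 0 < q → 0 < approxError Θ q) :
    uniformExponent Θ ≤ 1 := by
  by_contra! h
  obtain ⟨a, ha1, ha⟩ := EReal.lt_iff_exists_real_btwn.1 h
  have ha1 : 1 < a := by exact_mod_cast ha1
  have hdecay : Tendsto (fun k => 2 * (bestDenom Θ (k + 1) : ℝ) ^ (-(a - 1))) atTop (𝓝 0) := by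
    simpa using ((tendsto_rpow_neg_atTop (sub_pos.2 ha1)).comp
      ((tendsto_add_atTop_iff_nat 1).2 (tendsto_bestDenom hΘ))).const_mul 2
  obtain ⟨k, hk, hlt⟩ := ((eventually_approxError_bestDenom_le_rpow hΘ ha).and
    (hdecay.eventually_lt_const one_pos)).exists
  have hX : (0 : ℝ) < bestDenom Θ (k + 1) := Nat.cast_pos.2 (bestDenom_pos hΘ _)
  refine hlt.not_ge ?_
  calc 1 ≤ 2 * bestDenom Θ (k + 1) * approxError Θ (bestDenom Θ k) :=
        one_le_two_mul_approxError (bestDenom_strictMono hΘ k.lt_succ_self)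
          (approxError_bestDenom_strictAnti hΘ k.lt_succ_self)
    _ ≤ 2 * bestDenom Θ (k + 1) * (bestDenom Θ (k + 1) : ℝ) ^ (-a) := by gcongr
    _ = 2 * (bestDenom Θ (k + 1) : ℝ) ^ (-(a - 1)) := by
        rw [show -(a - 1) = 1 + -a by ring, Real.rpow_add hX, Real.rpow_one, mul_assoc]

theorem exists_real_uniformExponent_eq (hn : n ≠ 0) (hΘ : ∀ q, 0 < q → 0 < approxError Θ q) :
    ∃ α : ℝ, uniformExponent Θ = α ∧ 1 / n ≤ α ∧ α ≤ 1 := by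
  have hlower := one_div_le_uniformExponent (Θ := Θ) hn
  have hupper := uniformExponent_le_one hΘ
  have hα : uniformExponent Θ = (uniformExponent Θ).toReal :=
    (EReal.coe_toReal (hupper.trans_lt (EReal.coe_lt_top 1)).ne
      ((EReal.bot_lt_coe _).trans_le hlower).ne').symm
  rw [hα] at hlower hupper
  exact ⟨_, hα, EReal.coe_le_coe_iff.1 hlower, EReal.coe_le_coe_iff.1 hupper⟩

theorem rpow_le_of_gaps_le {a g C w y z z' : ℝ} (ha : 0 < a) (ha1 : a ≤ 1) (hg : 0 < g)
    (hag : (1 - a) * g ≤ 1) (hy : 0 < y) (hw : 0 < w) (hz' : 0 < z') (hC : 0 ≤ C) (hyz : y ≤ z)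
    (hyw : y ≤ w ^ g) (hzz' : z' ≤ z ^ g)
    (hz : z ≤ C * y * w ^ (-a) * y ^ (-a) * z' ^ (-a) * z') :
    y ^ (a + a / g - (1 - a) * g) ≤ C := by
  have hz0 : 0 < z := hy.trans_le hyz
  have hwy : w ^ (-a) ≤ y ^ (-(a / g)) := by
    calc w ^ (-a) = (w ^ g) ^ (-(a / g)) := by
          rw [← Real.rpow_mul hw.le]
          congr 1
          field_simp
      _ ≤ y ^ (-(a / g)) :=
          Real.rpow_le_rpow_of_nonpos hy hyw (neg_nonpos.2 (by positivity))
  have hz'z : z' ^ (-a) * z' ≤ z ^ ((1 - a) * g) := by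
    calc z' ^ (-a) * z' = z' ^ (1 - a) := by
          rw [sub_eq_neg_add, Real.rpow_add hz', Real.rpow_one]
      _ ≤ (z ^ g) ^ (1 - a) := Real.rpow_le_rpow hz'.le hzz' (by linarith)
      _ = z ^ ((1 - a) * g) := by rw [← Real.rpow_mul hz0.le, mul_comm]
  have hle : y ^ (1 - (1 - a) * g) ≤ C * y ^ (1 - a - a / g) := by
    calc y ^ (1 - (1 - a) * g) ≤ z ^ (1 - (1 - a) * g) :=
          Real.rpow_le_rpow hy.le hyz (by linarith)
      _ = z * z ^ (-((1 - a) * g)) := by rw [sub_eq_add_neg, Real.rpow_add hz0, Real.rpow_one]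
      _ ≤ C * y * y ^ (-(a / g)) * y ^ (-a) * z ^ ((1 - a) * g) * z ^ (-((1 - a) * g)) := by
          gcongr
          refine hz.trans ?_
          rw [mul_assoc _ (z' ^ (-a))]
          gcongr
      _ = C * y ^ (1 - a - a / g) := by
          rw [mul_assoc _ (z ^ _), ← Real.rpow_add hz0, add_neg_cancel, Real.rpow_zero, mul_one,
            sub_eq_add_neg, sub_eq_add_neg, Real.rpow_add hy, Real.rpow_add hy, Real.rpow_one]
          ring
  rw [show a + a / g - (1 - a) * g = 1 - (1 - a) * g - (1 - a - a / g) by ring,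
    Real.rpow_sub hy, div_le_iff₀ (by positivity)]
  exact hle

theorem frequently_rpow_le_bestDenom_succ (hn : 3 ≤ n) (hΘ : LinearIndependent ℤ (augment Θ))
    {a g : ℝ} (ha : 0 < a) (ha1 : a ≤ 1) (hg : 0 < g) (hag : (1 - a) * g ^ 2 < a * (g + 1))
    (hau : (a : EReal) < uniformExponent Θ) :
    ∃ᶠ k in atTop, (bestDenom Θ k : ℝ) ^ g ≤ bestDenom Θ (k + 1) := by
  have hpos (q : ℕ) (hq : 0 < q) : 0 < approxError Θ q :=
    approxError_pos_of_linearIndependent (by lia) hΘ hq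
  have hX (k : ℕ) : (0 : ℝ) < bestDenom Θ k := Nat.cast_pos.2 (bestDenom_pos hpos k)
  have hg1 : (1 - a) * g ≤ 1 := by
    by_contra! h
    have hsq : g ≤ (1 - a) * g ^ 2 := by
      calc g ≤ (1 - a) * g * g := le_mul_of_one_le_left hg.le h.le
        _ = (1 - a) * g ^ 2 := by ring
    linarith
  have hexp : 0 < a + a / g - (1 - a) * g := by
    have : a + a / g - (1 - a) * g = (a * (g + 1) - (1 - a) * g ^ 2) / g := by
      field_simp
    rw [this]
    exact div_pos (sub_pos.2 hag) hg
  intro hgap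
  have hlarge := ((tendsto_rpow_atTop hexp).comp
    ((tendsto_add_atTop_iff_nat 2).2 (tendsto_bestDenom hpos))).eventually_gt_atTop 36
  obtain ⟨k, ⟨i, hi, hle⟩, hk, hk36⟩ := ((frequently_exists_bestDenom_le hΘ hn).and_eventually
    ((eventually_forall_ge_atTop.2
      (hgap.and (eventually_approxError_bestDenom_le_rpow hpos hau))).and hlarge)).exists
  have hgap' (j : ℕ) (hj : k ≤ j) : (bestDenom Θ (j + 1) : ℝ) ≤ (bestDenom Θ j : ℝ) ^ g :=
    (not_le.1 (hk j hj).1).le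
  refine hk36.not_ge (rpow_le_of_gaps_le ha ha1 hg hg1 (hX (k + 2)) (hX (k + 1)) (hX (i + 1))
    (by norm_num) (Nat.cast_le.2 ((bestDenom_strictMono hpos).monotone hi))
    (hgap' (k + 1) k.le_succ) (hgap' i (by lia)) (hle.trans ?_))
  have herr (j : ℕ) (hj : k ≤ j) :
      approxError Θ (bestDenom Θ j) ≤ (bestDenom Θ (j + 1) : ℝ) ^ (-a) := (hk j hj).2
  have herr0 (j : ℕ) : 0 ≤ approxError Θ (bestDenom Θ j) := approxError_nonneg Θ _
  gcongr
  · exact herr0 i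
  · exact herr0 (k + 1)
  · exact herr k le_rfl
  · exact herr (k + 1) k.le_succ
  · exact herr i (by lia)

theorem mul_le_individualExponent_of_lt (hn : 3 ≤ n) (hΘ : LinearIndependent ℤ (augment Θ))
    {α g : ℝ} (hα : uniformExponent Θ = α) (hα0 : 0 < α) (hα1 : α ≤ 1) (hg : 0 < g)
    (hαg : (1 - α) * g ^ 2 < α * (g + 1)) : ((α * g : ℝ) : EReal) ≤ individualExponent Θ := by
  have hpos (q : ℕ) (hq : 0 < q) : 0 < approxError Θ q :=
    approxError_pos_of_linearIndependent (by lia) hΘ hq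
  have hlim : Tendsto (fun a : ℝ => ((a * g : ℝ) : EReal)) (𝓝[<] α) (𝓝 ((α * g : ℝ) : EReal)) :=
    (continuous_coe_real_ereal.comp (continuous_mul_const g)).continuousWithinAt
  have hnear : ∀ᶠ a in 𝓝[<] α, (1 - a) * g ^ 2 < a * (g + 1) :=
    nhdsWithin_le_nhds <| (Continuous.tendsto (by fun_prop) α).eventually_lt
      (Continuous.tendsto (by fun_prop) α) hαg
  refine le_of_tendsto hlim ?_
  filter_upwards [hnear, Ioo_mem_nhdsLT hα0] with a hag ⟨ha0, haα⟩
  have hau : (a : EReal) < uniformExponent Θ := hα ▸ EReal.coe_lt_coe_iff.2 haα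
  exact mul_le_individualExponent_of_frequently hpos ha0 hg hau
    (frequently_rpow_le_bestDenom_succ hn hΘ ha0 (haα.le.trans hα1) hg hag hau)

theorem mul_le_individualExponent (hn : 3 ≤ n) (hΘ : LinearIndependent ℤ (augment Θ))
    {α x : ℝ} (hα : uniformExponent Θ = α) (hα0 : 0 < α) (hα1 : α ≤ 1)
    (hx : (1 - α) * x ^ 2 ≤ α * (x + 1)) : ((α * x : ℝ) : EReal) ≤ individualExponent Θ := by
  rcases le_or_gt x 0 with hx0 | hx0
  · calc ((α * x : ℝ) : EReal) ≤ α :=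
          EReal.coe_le_coe_iff.2 (mul_le_of_le_one_right hα0.le (hx0.trans zero_le_one))
      _ = uniformExponent Θ := hα.symm
      _ ≤ individualExponent Θ := uniformExponent_le_individualExponent
  have hlim : Tendsto (fun g : ℝ => ((α * g : ℝ) : EReal)) (𝓝[<] x) (𝓝 ((α * x : ℝ) : EReal)) :=
    (continuous_coe_real_ereal.comp (continuous_const_mul α)).continuousWithinAt
  refine le_of_tendsto hlim ?_
  filter_upwards [Ioo_mem_nhdsLT hx0] with g ⟨hg0, hgx⟩
  refine mul_le_individualExponent_of_lt hn hΘ hα hα0 hα1 hg0 ?_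
  -- The quotient `g ^ 2 / (g + 1)` is strictly increasing.
  have hmono : (x + 1) * g ^ 2 < (g + 1) * x ^ 2 := by
    nlinarith [mul_pos hg0 hx0, mul_pos (mul_pos hg0 hx0) (sub_pos.2 hgx)]
  have hscaled : (x + 1) * ((1 - α) * g ^ 2) < (x + 1) * (α * (g + 1)) := by
    rcases hα1.eq_or_lt with rfl | hα1
    · have : 0 < (x + 1) * (g + 1) := by positivity
      linarith
    · calc (x + 1) * ((1 - α) * g ^ 2) = (1 - α) * ((x + 1) * g ^ 2) := by ring
        _ < (1 - α) * ((g + 1) * x ^ 2) := mul_lt_mul_of_pos_left hmono (sub_pos.2 hα1)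
        _ = (g + 1) * ((1 - α) * x ^ 2) := by ring
        _ ≤ (g + 1) * (α * (x + 1)) := by gcongr
        _ = (x + 1) * (α * (g + 1)) := by ring
  exact lt_of_mul_lt_mul_left hscaled (by positivity)

end Bounds

end Diophantine

open Diophantine in
theorem theorem2_general {n : ℕ} (hn : 3 ≤ n) (Θ : Matrix (Fin n) (Fin 1) ℝ)
    (hΘ : LinearIndependent ℤ (augment Θ)) :
    (∀ t : ℝ, 1 ≤ t → 0 < psi Θ t) ∧
      ∃ α : ℝ, uniformExponent Θ = α ∧ 1 / n ≤ α ∧ α ≤ 1 ∧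
        ∀ x : ℝ, (1 - α) * x ^ 2 ≤ α * (x + 1) →
          ((α * x : ℝ) : EReal) ≤ individualExponent Θ := by
  have hpos (q : ℕ) (hq : 0 < q) : 0 < approxError Θ q :=
    approxError_pos_of_linearIndependent (by lia) hΘ hq
  obtain ⟨α, hα, hlower, hα1⟩ := exists_real_uniformExponent_eq (by lia) hpos
  have hα0 : 0 < α := lt_of_lt_of_le (by positivity) hlower
  exact ⟨fun _ => psi_pos hpos, α, hα, hlower, hα1,
    fun _ => mul_le_individualExponent hn hΘ hα hα0 hα1⟩

theorem theorem2 :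
    -- `g₁(a)` is the largest root of the quadratic equation
    (∀ a : ℝ, 0 < a →
      IsGreatest {x : ℝ | (2 * a ^ 2 - 2 * a + 1) * x ^ 2 + a * (a - 1) * x - a = 0}
        (Diophantine.g1 a)) ∧
    -- `α(Θ)` is a real number in `[1/3, 1]`, and `β(Θ) ≥ α(Θ) g₁(α(Θ))`
    (∀ θ₁ θ₂ θ₃ : ℝ, LinearIndependent ℤ ![1, θ₁, θ₂, θ₃] →
      (∀ t : ℝ, 1 ≤ t → 0 < Diophantine.psi !![θ₁; θ₂; θ₃] t) ∧
      ∃ α : ℝ, Diophantine.uniformExponent !![θ₁; θ₂; θ₃] = (α : EReal) ∧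
        1 / 3 ≤ α ∧ α ≤ 1 ∧
        ((α * Diophantine.g1 α : ℝ) : EReal) ≤
          Diophantine.individualExponent !![θ₁; θ₂; θ₃]) ∧
    -- the bound is better than `α² / (1 - α)` for `1/3 < α < α₀`
    (∃ α₀ : ℝ, (∀ x : ℝ, x ^ 3 - x ^ 2 + 2 * x - 1 = 0 ↔ x = α₀) ∧
      1 / 3 < α₀ ∧ α₀ < 1 ∧
      ∀ a : ℝ, 1 / 3 < a → a < α₀ → a ^ 2 / (1 - a) < a * Diophantine.g1 a) := by
  refine ⟨fun _ => Diophantine.isGreatest_g1, fun θ₁ θ₂ θ₃ hθ => ?_,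
    Diophantine.exists_unique_cubic_root_and_sq_div_one_sub_lt⟩
  have haugment : Diophantine.augment !![θ₁; θ₂; θ₃] = ![1, θ₁, θ₂, θ₃] := by
    ext i
    fin_cases i <;> rfl
  obtain ⟨hpsi, α, hα, h3, h1, hβ⟩ := theorem2_general le_rfl !![θ₁; θ₂; θ₃] (haugment ▸ hθ)
  have h3 : 1 / 3 ≤ α := mod_cast h3
  exact ⟨hpsi, α, hα, h3, h1, hβ _ (Diophantine.one_sub_mul_g1_sq_le h3 h1)⟩
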